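/- Let $k\ge 1$ and let $A-\lambda B$ be a singular pencil with $A,B\in\mathbb R^{n\times n}$ and $\operatorname{nrank}(A,B)=\max_{\zeta}\operatorname{rank}(A-\zeta B)=n-k$. Let $\lambda_i\in\mathbb R$ be a finite simple eigenvalue of $A-\lambda B$, that is, a simple root of $\det R(\lambda)$, where $R(\lambda)$ is the regular part of the Kronecker canonical form of the pencil. A subspace $\mathcal M$ (resp. $\mathcal L$) of $\mathbb R^n$ is called reducing (resp. left reducing) if $\dim(A\mathcal M+B\mathcal M)=\dim\mathcal M-k$ (resp. $\dim(A^T\mathcal L+B^T\mathcal L)=\dim\mathcal L-k$); let $\mathcal M_{\rm RS}$ (resp. $\mathcal L_{\rm RS}$) be the intersection of all reducing (resp. left reducing) subspaces. Let $X=[X_1\ x]$ and $Y=[Y_1\ y]$ be real $n\times(k+1)$ matrices with orthonormal columns such that the columns of $X_1$, $X$, $Y_1$, $Y$ form bases of $\ker(A-\lambda_iB)\cap\mathcal M_{\rm RS}$, $\ker(A-\lambda_iB)$, $\ker((A-\lambda_iB)^T)\cap\mathcal L_{\rm RS}$, $\ker((A-\lambda_iB)^T)$, respectively. Let $U,V$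 be independent random matrices, uniformly distributed on the real Stiefel manifold $\{Q\in\mathbb R^{n\times k}: Q^TQ=I\}$, let $\tau\ne0$ be real, and let $D_A,D_B$ be real diagonal $k\times k$ matrices (possibly random) such that $\det(D_A-\lambda_iD_B)\neq 0$ almost surely. Let $x_i$ and $y_i$ be right and left eigenvectors, of Euclidean norm $1$, of the perturbed pencil $$\widetilde A-\lambda\widetilde B=A-\lambda B+\tau\,(UD_AV^T-\lambda\,UD_BV^T)$$ for the eigenvalue $\lambda_i$. Then, almost surely, $V^Tx_i=0$, $U^Ty_i=0$ and $$x_i=[X_1\ x]\begin{bmatrix}a\\ \alpha_{\mathbb R}\end{bmatrix},\qquad y_i=[Y_1\ y]\begin{bmatrix}b\\ \beta_{\mathbb R}\end{bmatrix}$$ with $a,b\in\mathbb R^k$, $\alpha_{\mathbb R}=x^Tx_i$ and $\beta_{\mathbb R}=y^Ty_i$, and $$\mathbb P\left(|\alpha_{\mathbb R}||\beta_{\mathbb R}|<t\right)\ \ge\ \sqrt{\frac{8(k-1)}{\pi}}\;t+\mathcal O(t^2),\qquad t\to0,$$ where the $\mathcal O(t^2)$ term depends only on $k$ and $t$. -/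

import Mathlib

open Matrix Polynomial Filter Topology Asymptotics MeasureTheory ProbabilityTheory

/-! ### Matrix pencils `A - λ B`, Kronecker canonical form, simple eigenvalues -/

/-- The normal rank of the square pencil `A - λ B`: the largest rank of `A - z B` over all
scalars `z` (the ranks are bounded by `n`). -/
noncomputable def nrank {K : Type*} [Field K] {n : ℕ} (A B : Matrix (Fin n) (Fin n) K) : ℕ :=
  ⨆ z : K, (A - z • B).rank

/-- The Jordan block of size `d` with eigenvalue `μ`. -/
def jordanBlock {K : Type*} [Field K] (μ : K) (d : ℕ) : Matrix (Fin d) (Fin d) K :=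
  Matrix.of fun a b => if a = b then μ else if a.val + 1 = b.val then 1 else 0

/-- The `j × (j+1)` matrix `[0 I_j]`. -/
def shiftRight (K : Type*) [Field K] (j : ℕ) : Matrix (Fin j) (Fin (j + 1)) K :=
  Matrix.of fun a b => if b = a.succ then 1 else 0

/-- The `j × (j+1)` matrix `[I_j 0]`. -/
def shiftLeft (K : Type*) [Field K] (j : ℕ) : Matrix (Fin j) (Fin (j + 1)) K :=
  Matrix.of fun a b => if b = a.castSucc then 1 else 0

/-- The parameters of a square Kronecker canonical form with `k` right singular blocks
and `k` left singular blocks. -/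
structure KroneckerData (K : Type*) (k : ℕ) where
  /-- number of Jordan blocks belonging to finite eigenvalues -/
  p : ℕ
  /-- sizes of these Jordan blocks -/
  d : Fin p → ℕ
  /-- eigenvalues of these Jordan blocks -/
  ev : Fin p → K
  /-- number of nilpotent Jordan blocks (infinite eigenvalue) -/
  q : ℕ
  /-- sizes of the nilpotent Jordan blocks -/
  e : Fin q → ℕ
  /-- right minimal indices -/
  rightIdx : Fin k → ℕ
  /-- left minimal indices -/
  leftIdx : Fin k → ℕ

namespace KroneckerData

variable {K : Type*} [Field K] {k : ℕ}

/-- Index type of the regular part. -/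
abbrev RegIdx (D : KroneckerData K k) : Type :=
  (Σ i : Fin D.p, Fin (D.d i)) ⊕ (Σ i : Fin D.q, Fin (D.e i))

/-- Row index type of the singular part. -/
abbrev SingRow (D : KroneckerData K k) : Type :=
  (Σ i : Fin k, Fin (D.rightIdx i)) ⊕ (Σ i : Fin k, Fin (D.leftIdx i + 1))

/-- Column index type of the singular part. -/
abbrev SingCol (D : KroneckerData K k) : Type :=
  (Σ i : Fin k, Fin (D.rightIdx i + 1)) ⊕ (Σ i : Fin k, Fin (D.leftIdx i))

/-- The matrix `J`, in Jordan canonical form. -/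
def jordanPart (D : KroneckerData K k) :
    Matrix (Σ i : Fin D.p, Fin (D.d i)) (Σ i : Fin D.p, Fin (D.d i)) K :=
  Matrix.blockDiagonal' fun i => jordanBlock (D.ev i) (D.d i)

/-- The nilpotent matrix `N`, in Jordan canonical form. -/
def nilPart (D : KroneckerData K k) :
    Matrix (Σ i : Fin D.q, Fin (D.e i)) (Σ i : Fin D.q, Fin (D.e i)) K :=
  Matrix.blockDiagonal' fun i => jordanBlock 0 (D.e i)

/-- The constant coefficient `diag(J, I)` of the regular part
`R(λ) = diag(J - λ I, I - λ N) = regA - λ regB`. -/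
def regA (D : KroneckerData K k) : Matrix D.RegIdx D.RegIdx K :=
  Matrix.fromBlocks D.jordanPart 0 0 1

/-- The coefficient `diag(I, N)` of `-λ` in the regular part. -/
def regB (D : KroneckerData K k) : Matrix D.RegIdx D.RegIdx K :=
  Matrix.fromBlocks 1 0 0 D.nilPart

/-- The constant coefficient of the singular part
`S(λ) = diag(L_{m_1}(λ), …, L_{m_k}(λ), L_{n_1}(λ)ᵀ, …, L_{n_k}(λ)ᵀ) = singA - λ singB`,
where `L_j(λ) = [0 I_j] - λ [I_j 0]`. -/
def singA (D : KroneckerData K k) : Matrix D.SingRow D.SingCol K :=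
  Matrix.fromBlocks (Matrix.blockDiagonal' fun i => shiftRight K (D.rightIdx i)) 0 0
    (Matrix.blockDiagonal' fun i => (shiftRight K (D.leftIdx i))ᵀ)

/-- The coefficient of `-λ` in the singular part. -/
def singB (D : KroneckerData K k) : Matrix D.SingRow D.SingCol K :=
  Matrix.fromBlocks (Matrix.blockDiagonal' fun i => shiftLeft K (D.rightIdx i)) 0 0
    (Matrix.blockDiagonal' fun i => (shiftLeft K (D.leftIdx i))ᵀ)

/-- `D` describes a Kronecker canonical form of `A - λ B`: there are nonsingular `P`, `Q` with
`P (A - λ B) Q = diag(R(λ), S(λ))`, written out for the two coefficients of the pencil.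
The bijections number the rows and columns of the block matrix by `Fin n`. -/
def IsFormOf (D : KroneckerData K k) {n : ℕ} (A B : Matrix (Fin n) (Fin n) K) : Prop :=
  ∃ (er : D.RegIdx ⊕ D.SingRow ≃ Fin n) (ec : D.RegIdx ⊕ D.SingCol ≃ Fin n)
    (P Q : Matrix (Fin n) (Fin n) K), IsUnit P.det ∧ IsUnit Q.det ∧
      P * A * Q = Matrix.reindex er ec (Matrix.fromBlocks D.regA 0 0 D.singA) ∧
      P * B * Q = Matrix.reindex er ec (Matrix.fromBlocks D.regB 0 0 D.singB)

/-- The polynomial `det R(λ)`. -/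
noncomputable def regDet (D : KroneckerData K k) : K[X] :=
  (D.regA.map Polynomial.C - (Polynomial.X : K[X]) • D.regB.map Polynomial.C).det

end KroneckerData

/-- `μ` is a finite simple eigenvalue of the complex pencil `A - λ B`: it is a simple root of
`det R(λ)`, where `R(λ)` is the regular part of the Kronecker canonical form. -/
def IsSimpleEigenvalue {n : ℕ} (A B : Matrix (Fin n) (Fin n) ℂ) (μ : ℂ) : Prop :=
  ∃ (k : ℕ) (D : KroneckerData ℂ k), D.IsFormOf A B ∧ D.regDet.rootMultiplicity μ = 1

/-! ### Minimal reducing subspaces and the adapted orthonormal bases -/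

/-- `M` is a reducing subspace of `A - λ B`: `dim (A M + B M) = dim M - k`,
`k = n - nrank(A, B)`. -/
def IsReducing {n : ℕ} (A B : Matrix (Fin n) (Fin n) ℝ) (M : Submodule ℝ (Fin n → ℝ)) : Prop :=
  Module.finrank ℝ ↥(M.map A.mulVecLin ⊔ M.map B.mulVecLin) + (n - nrank A B)
    = Module.finrank ℝ M

/-- `L` is a left reducing subspace of `A - λ B`: `dim (Aᵀ L + Bᵀ L) = dim L - k`,
`k = n - nrank(A, B)`. -/
def IsLeftReducing {n : ℕ} (A B : Matrix (Fin n) (Fin n) ℝ)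
    (L : Submodule ℝ (Fin n → ℝ)) : Prop :=
  Module.finrank ℝ ↥(L.map Aᵀ.mulVecLin ⊔ L.map Bᵀ.mulVecLin) + (n - nrank A B)
    = Module.finrank ℝ L

/-- The minimal reducing subspace: the intersection of all reducing subspaces. -/
noncomputable def minReducing {n : ℕ} (A B : Matrix (Fin n) (Fin n) ℝ) :
    Submodule ℝ (Fin n → ℝ) :=
  sInf {M | IsReducing A B M}

/-- The minimal left reducing subspace: the intersection of all left reducing subspaces. -/
noncomputable def minLeftReducing {n : ℕ} (A B : Matrix (Fin n) (Fin n) ℝ) :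
    Submodule ℝ (Fin n → ℝ) :=
  sInf {L | IsLeftReducing A B L}

/-- The column space of a matrix. -/
def colSpan {n : ℕ} {ι : Type*} (X : Matrix (Fin n) ι ℝ) : Submodule ℝ (Fin n → ℝ) :=
  Submodule.span ℝ (Set.range fun j => fun i => X i j)

/-- The matrix `[X₁ x]` obtained by appending the column `x` to `X₁`. -/
def appendCol {n k : ℕ} (X₁ : Matrix (Fin n) (Fin k) ℝ) (x : Fin n → ℝ) :
    Matrix (Fin n) (Fin k ⊕ Unit) ℝ :=
  Matrix.fromCols X₁ (Matrix.of fun i _ => x i)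

/-- `X = [X₁ x]` has orthonormal columns, `X₁` is a basis of
`ker (A - μ B) ∩ M_RS(A, B)` and `X` is a basis of `ker (A - μ B)`. -/
structure IsRightAdapted {n k : ℕ} (A B : Matrix (Fin n) (Fin n) ℝ) (μ : ℝ)
    (X₁ : Matrix (Fin n) (Fin k) ℝ) (x : Fin n → ℝ) : Prop where
  orthonormal : (appendCol X₁ x)ᵀ * appendCol X₁ x = 1
  span_fst : colSpan X₁ = LinearMap.ker (A - μ • B).mulVecLin ⊓ minReducing A B
  span_all : colSpan (appendCol X₁ x) = LinearMap.ker (A - μ • B).mulVecLin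

/-- `Y = [Y₁ y]` has orthonormal columns, `Y₁` is a basis of
`ker (A - μ B)ᵀ ∩ L_RS(A, B)` and `Y` is a basis of `ker (A - μ B)ᵀ`. -/
structure IsLeftAdapted {n k : ℕ} (A B : Matrix (Fin n) (Fin n) ℝ) (μ : ℝ)
    (Y₁ : Matrix (Fin n) (Fin k) ℝ) (y : Fin n → ℝ) : Prop where
  orthonormal : (appendCol Y₁ y)ᵀ * appendCol Y₁ y = 1
  span_fst : colSpan Y₁ = LinearMap.ker (A - μ • B)ᵀ.mulVecLin ⊓ minLeftReducing A B
  span_all : colSpan (appendCol Y₁ y) = LinearMap.ker (A - μ • B)ᵀ.mulVecLin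

/-! ### The rank-completing perturbation and the uniform distribution on the Stiefel manifold -/

/-- The modified coefficient `A + τ U diag(d) Vᵀ`. -/
def rankCompleting {n k : ℕ} (A : Matrix (Fin n) (Fin n) ℝ) (τ : ℝ)
    (U V : Matrix (Fin n) (Fin k) ℝ) (d : Fin k → ℝ) : Matrix (Fin n) (Fin n) ℝ :=
  A + τ • (U * Matrix.diagonal d * Vᵀ)

/-- `v` is a right eigenvector of the pencil `A - λ B` for `μ`, of Euclidean norm `1`. -/
def IsUnitRightEigenvector {n : ℕ} (A B : Matrix (Fin n) (Fin n) ℝ) (μ : ℝ)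
    (v : Fin n → ℝ) : Prop :=
  (A - μ • B) *ᵥ v = 0 ∧ v ⬝ᵥ v = 1

/-- `w` is a left eigenvector of the pencil `A - λ B` for `μ`, of Euclidean norm `1`. -/
def IsUnitLeftEigenvector {n : ℕ} (A B : Matrix (Fin n) (Fin n) ℝ) (μ : ℝ)
    (w : Fin n → ℝ) : Prop :=
  w ᵥ* (A - μ • B) = 0 ∧ w ⬝ᵥ w = 1

/-- The real Stiefel manifold of `n × k` matrices with orthonormal columns. -/
def stiefel (n k : ℕ) : Set (Matrix (Fin n) (Fin k) ℝ) :=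
  {Q | Qᵀ * Q = 1}

/-- The Borel `σ`-algebra on real matrices (the product `σ`-algebra of the entries). -/
instance matrixMeasurableSpace (m n : ℕ) : MeasurableSpace (Matrix (Fin m) (Fin n) ℝ) :=
  inferInstanceAs (MeasurableSpace (Fin m → Fin n → ℝ))

/-- `ν` is the uniform distribution on the Stiefel manifold: the (unique) probability measure
carried by the Stiefel manifold that is invariant under the transitive action of the orthogonal
group by left multiplication. -/
structure IsUniformOnStiefel {n k : ℕ} (ν : Measure (Matrix (Fin n) (Fin k) ℝ)) : Prop where
  isProbabilityMeasure : IsProbabilityMeasure ν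
  carried : ∀ᵐ Q ∂ν, Q ∈ stiefel n k
  invariant : ∀ O : Matrix (Fin n) (Fin n) ℝ, Oᵀ * O = 1 → ν.map (fun Q => O * Q) = ν

/-! The linear bound has room to spare. Multiplying the eigenvalue equation by `Y₁ᵀ` shows that
almost surely `xi` lies in `ker (A - μ B)` and is orthogonal to the columns of `V`. Its coordinates
in the basis `[X₁ x]` are then, up to sign, the normalized cross product of the `k` columns of
`XᵀV`, and `|α|` is the cosine of its angle with the last basis vector. Symmetrically, `|β|` depends
only on `U`, so the two cosines are independent.

By rotation invariance each cosine falls in `[a, 8a)` with probability at least `κ a` for small `a`,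
where `κ` depends only on `k` (`exists_le_measureReal_inCone`). A product of two independent
variables of this kind is below `t` with probability of order at least `t log (1/t)`: each way of
splitting `t` between the factors on a scale of powers of 8 contributes a fixed multiple of `t`
(`exists_mul_le_measureReal_mul_lt`). This exceeds `C t` for any `C` once `t` is small, so the error
term can be taken to vanish near `0`. -/

/-! ### Generalized cross product -/

/-- The generalized cross product of the columns of a `(k+1) × k` matrix. -/
noncomputable def crossVec {k : ℕ} (G : Matrix (Fin k ⊕ Unit) (Fin k) ℝ) : Fin k ⊕ Unit → ℝ :=
  (fromCols G (0 : Matrix (Fin k ⊕ Unit) Unit ℝ)).adjugate (Sum.inr ())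

theorem crossVec_dotProduct {k : ℕ} (G : Matrix (Fin k ⊕ Unit) (Fin k) ℝ) (u : Fin k ⊕ Unit → ℝ) :
    crossVec G ⬝ᵥ u = (fromCols G (replicateCol Unit u)).det := by
  have h : crossVec G ⬝ᵥ u
      = (fromCols G (0 : Matrix (Fin k ⊕ Unit) Unit ℝ)).cramer u (Sum.inr ()) := by
    rw [cramer_eq_adjugate_mulVec]; rfl
  rw [h, cramer_apply]
  congr 1
  ext i (j | j) <;> simp

theorem transpose_mulVec_crossVec {k : ℕ} (G : Matrix (Fin k ⊕ Unit) (Fin k) ℝ) :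
    Gᵀ *ᵥ crossVec G = 0 := by
  ext j
  have h : (Gᵀ *ᵥ crossVec G) j = crossVec G ⬝ᵥ (fun i => G i j) := by
    rw [dotProduct_comm]; rfl
  rw [h, crossVec_dotProduct]
  exact det_zero_of_column_eq (i := Sum.inl j) (j := Sum.inr ()) (by simp) (by simp)

theorem crossVec_inr {k : ℕ} (G : Matrix (Fin k ⊕ Unit) (Fin k) ℝ) :
    crossVec G (Sum.inr ()) = G.toRows₁.det := by
  have h : crossVec G (Sum.inr ()) = crossVec G ⬝ᵥ Pi.single (Sum.inr ()) 1 := by simp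
  rw [h, crossVec_dotProduct]
  have : fromCols G (replicateCol Unit (Pi.single (Sum.inr ()) (1 : ℝ)))
      = fromBlocks G.toRows₁ 0 G.toRows₂ 1 := by
    ext (i | i) (j | j) <;> simp [fromBlocks]
  rw [this, det_fromBlocks_zero₁₂]; simp

theorem crossVec_mul {k : ℕ} {W : Matrix (Fin k ⊕ Unit) (Fin k ⊕ Unit) ℝ} (hW : Wᵀ * W = 1)
    (G : Matrix (Fin k ⊕ Unit) (Fin k) ℝ) :
    crossVec (W * G) = W.det • (W *ᵥ crossVec G) := by
  have hW' : W * Wᵀ = 1 := mul_eq_one_comm.mp hW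
  refine dotProduct_eq _ _ fun v => ?_
  have hv : v = W *ᵥ (Wᵀ *ᵥ v) := by simp [hW']
  have e : fromCols (W * G) (replicateCol Unit v) = W * fromCols G (replicateCol Unit (Wᵀ *ᵥ v)) := by
    rw [mul_fromCols]
    congr 1
    conv_lhs => rw [hv]
    rw [replicateCol_mulVec]
  rw [crossVec_dotProduct, e, det_mul, ← crossVec_dotProduct, smul_dotProduct, smul_eq_mul,
    dotProduct_mulVec, vecMul_transpose]

/-- The product `[G a]ᵀ [G u]` is block triangular because `a` is orthogonal to the columns of `G`.
-/
theorem det_fromCols_mul_of_transpose_mulVec_eq_zero {k : ℕ}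
    {G : Matrix (Fin k ⊕ Unit) (Fin k) ℝ} {a : Fin k ⊕ Unit → ℝ} (ha : Gᵀ *ᵥ a = 0)
    (u : Fin k ⊕ Unit → ℝ) :
    (crossVec G ⬝ᵥ a) * (crossVec G ⬝ᵥ u) = (Gᵀ * G).det * (a ⬝ᵥ u) := by
  rw [crossVec_dotProduct, crossVec_dotProduct, ← det_transpose, ← det_mul, transpose_fromCols,
    fromRows_mul_fromCols]
  have h : (replicateCol Unit a)ᵀ * G = 0 := by
    ext i j
    have := congrFun ha j
    simpa [Matrix.mul_apply, mulVec, dotProduct, mul_comm] using this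
  rw [h, det_fromBlocks_zero₂₁]
  congr 1
  simp [Matrix.mul_apply, dotProduct]

/-- Says that `a` is the normalized cross product up to sign. The Gram identity gives `c ⬝ᵥ c = det
(GᵀG)` for the cross product `c`, which replaces a dimension count for the kernel of `Gᵀ`. -/
theorem sq_crossVec_dotProduct {k : ℕ} {G : Matrix (Fin k ⊕ Unit) (Fin k) ℝ}
    {a : Fin k ⊕ Unit → ℝ} (hc : crossVec G ≠ 0) (ha : Gᵀ *ᵥ a = 0) (ha1 : a ⬝ᵥ a = 1)
    (u : Fin k ⊕ Unit → ℝ) :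
    (crossVec G ⬝ᵥ u) ^ 2 = (crossVec G ⬝ᵥ crossVec G) * (a ⬝ᵥ u) ^ 2 := by
  have h0 : crossVec G ⬝ᵥ crossVec G ≠ 0 := fun h => hc (dotProduct_self_eq_zero.mp h)
  have h1 := det_fromCols_mul_of_transpose_mulVec_eq_zero (transpose_mulVec_crossVec G) (crossVec G)
  have h2 := mul_right_cancel₀ h0 h1
  have h3 := det_fromCols_mul_of_transpose_mulVec_eq_zero ha a
  have h4 := det_fromCols_mul_of_transpose_mulVec_eq_zero ha u
  rw [← h2] at h3 h4
  rw [ha1, mul_one] at h3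
  refine mul_left_cancel₀ h0 ?_
  calc _ = ((crossVec G ⬝ᵥ a) * (crossVec G ⬝ᵥ u)) ^ 2 := by rw [← h3]; ring
    _ = _ := by rw [h4]; ring

/-! ### Cones and orthogonal maps -/

/-- The cosine of the angle between `c` and `u` is, up to sign, in `[a, 8a)`. -/
def InCone {ι : Type*} [Fintype ι] (a : ℝ) (c u : ι → ℝ) : Prop :=
  a ^ 2 * ((c ⬝ᵥ c) * (u ⬝ᵥ u)) ≤ (c ⬝ᵥ u) ^ 2 ∧
    (c ⬝ᵥ u) ^ 2 < (8 * a) ^ 2 * ((c ⬝ᵥ c) * (u ⬝ᵥ u))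

theorem dotProduct_orthogonal {ι : Type*} [Fintype ι] [DecidableEq ι] {W : Matrix ι ι ℝ}
    (hW : Wᵀ * W = 1) (u v : ι → ℝ) : (W *ᵥ u) ⬝ᵥ (W *ᵥ v) = u ⬝ᵥ v := by
  rw [dotProduct_mulVec, vecMul_mulVec, hW, vecMul_one]

theorem inCone_orthogonal {ι : Type*} [Fintype ι] [DecidableEq ι] {W : Matrix ι ι ℝ}
    (hW : Wᵀ * W = 1) (a : ℝ) (c u : ι → ℝ) : InCone a (W *ᵥ c) (W *ᵥ u) ↔ InCone a c u := by
  simp only [InCone, dotProduct_orthogonal hW]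

theorem inCone_smul_left {ι : Type*} [Fintype ι] {s : ℝ} (hs : s ≠ 0) (a : ℝ) (c u : ι → ℝ) :
    InCone a (s • c) u ↔ InCone a c u := by
  have h : 0 < s ^ 2 := by positivity
  simp only [InCone, smul_dotProduct, dotProduct_smul, smul_eq_mul]
  rw [show a ^ 2 * (s * (s * (c ⬝ᵥ c)) * (u ⬝ᵥ u)) = s ^ 2 * (a ^ 2 * ((c ⬝ᵥ c) * (u ⬝ᵥ u))) by ring,
    show (8 * a) ^ 2 * (s * (s * (c ⬝ᵥ c)) * (u ⬝ᵥ u))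
      = s ^ 2 * ((8 * a) ^ 2 * ((c ⬝ᵥ c) * (u ⬝ᵥ u))) by ring, mul_pow,
    mul_le_mul_iff_right₀ h, mul_lt_mul_iff_right₀ h]

theorem inCone_comm {ι : Type*} [Fintype ι] (a : ℝ) (c u : ι → ℝ) :
    InCone a c u ↔ InCone a u c := by
  simp only [InCone, dotProduct_comm c u, mul_comm (c ⬝ᵥ c)]

/-- Householder: a vector is a nonzero multiple of an orthogonal image of any given one. -/
theorem exists_orthogonal_mulVec_eq_smul {ι : Type*} [Fintype ι] [DecidableEq ι] {e u : ι → ℝ}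
    (he : e ⬝ᵥ e = 1) (hu : u ≠ 0) :
    ∃ (W : Matrix ι ι ℝ) (s : ℝ), Wᵀ * W = 1 ∧ s ≠ 0 ∧ u = s • (W *ᵥ e) := by
  have hpos : 0 < u ⬝ᵥ u := by
    simpa using dotProduct_star_self_pos_iff.mpr hu
  set s := √(u ⬝ᵥ u) with hs
  have hs0 : 0 < s := Real.sqrt_pos.mpr hpos
  have hss : s * s = u ⬝ᵥ u := Real.mul_self_sqrt hpos.le
  set v := s⁻¹ • u with hv
  have hvv : v ⬝ᵥ v = 1 := by
    simp only [hv, smul_dotProduct, dotProduct_smul, smul_eq_mul, ← hss]; field_simp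
  have huv : u = s • v := by rw [hv, smul_smul, mul_inv_cancel₀ hs0.ne', one_smul]
  by_cases hev : e = v
  · exact ⟨1, s, by simp, hs0.ne', by simpa [hev] using huv⟩
  set w := e - v with hw
  have hw0 : w ⬝ᵥ w ≠ 0 := fun h => hev (sub_eq_zero.mp (dotProduct_self_eq_zero.mp h))
  have hww : w ⬝ᵥ w = 2 * (w ⬝ᵥ e) := by
    simp only [hw, sub_dotProduct, dotProduct_sub, he, hvv, dotProduct_comm e v]; ring
  set W : Matrix ι ι ℝ := 1 - (2 / (w ⬝ᵥ w)) • vecMulVec w w with hW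
  have hWT : Wᵀ = W := by simp [hW, transpose_vecMulVec]
  refine ⟨W, s, ?_, hs0.ne', ?_⟩
  · rw [hWT, hW]
    simp only [sub_mul, mul_sub, one_mul, mul_one, smul_mul, Matrix.mul_smul, vecMulVec_mul_vecMulVec,
      smul_smul]
    have : (2 / (w ⬝ᵥ w) * (2 / (w ⬝ᵥ w))) • vecMulVec w ((w ⬝ᵥ w) • w)
        = (2 * (2 / (w ⬝ᵥ w))) • vecMulVec w w := by
      rw [vecMulVec_smul, smul_smul]; congr 1; field_simp
    rw [this, two_mul, add_smul]; abel
  · rw [huv]; congr 1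
    rw [hW, sub_mulVec, one_mulVec, smul_mulVec, vecMulVec_mulVec]
    have : (2 / (w ⬝ᵥ w)) • (MulOpposite.op (w ⬝ᵥ e) • w) = w := by
      rw [op_smul_eq_smul, smul_smul, hww]
      have : w ⬝ᵥ e ≠ 0 := by intro h; apply hw0; rw [hww, h, mul_zero]
      rw [show 2 / (2 * (w ⬝ᵥ e)) * (w ⬝ᵥ e) = 1 by field_simp, one_smul]
    rw [this, hw]; abel

/-! ### Almost sure nondegeneracy of a uniform frame -/

/-- On each line `Z + x V` the determinant is a characteristic polynomial in `x`, hence monic with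
finitely many roots; Fubini along these lines does the rest. -/
theorem ae_det_transpose_mul_ne_zero {n k : ℕ} {V : Matrix (Fin n) (Fin k) ℝ} (hV : Vᵀ * V = 1) :
    ∀ᵐ Z : Fin n → Fin k → ℝ, ((Matrix.of Z)ᵀ * V).det ≠ 0 := by
  let V' : Fin n → Fin k → ℝ := V
  have hcont : Continuous fun Z : Fin n → Fin k → ℝ => ((Matrix.of Z)ᵀ * V).det := by
    refine Continuous.matrix_det (Continuous.matrix_mul (Continuous.matrix_transpose ?_) continuous_const)
    exact continuous_id
  refine ae_mem_of_ae_add_linearMap_mem (𝕜 := ℝ) (LinearMap.toSpanSingleton ℝ _ V') volume volume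
    (s := {Z | ((Matrix.of Z)ᵀ * V).det ≠ 0}) (hcont.measurable (measurableSet_singleton 0).compl) ?_
  intro Z
  have h : {x : ℝ | ¬ (Z + LinearMap.toSpanSingleton ℝ _ V' x) ∈ {Z | ((Matrix.of Z)ᵀ * V).det ≠ 0}}
      ⊆ {x | (-((Matrix.of Z)ᵀ * V)).charpoly.IsRoot x} := by
    intro x hx
    simp only [Set.mem_ofPred_eq, not_not] at hx
    have e : (Matrix.of (Z + LinearMap.toSpanSingleton ℝ _ V' x))ᵀ * V
        = scalar _ x - -((Matrix.of Z)ᵀ * V) := by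
      have : Matrix.of (Z + LinearMap.toSpanSingleton ℝ _ V' x) = Matrix.of Z + x • V := rfl
      rw [this, transpose_add, transpose_smul, Matrix.add_mul, Matrix.smul_mul, hV, sub_neg_eq_add, add_comm,
        smul_one_eq_diagonal]
      rfl
    rw [e] at hx
    simp only [Set.mem_ofPred_eq, IsRoot, eval_charpoly, hx]
  refine measure_mono_null h (Set.Finite.measure_zero ?_ _)
  exact Polynomial.finite_setOfPred_isRoot (charpoly_monic _).ne_zero

/-- A frame can be rotated into the column space of a given orthonormal frame. -/
theorem exists_orthogonal_mul_eq_mul {n k : ℕ} {X Z : Matrix (Fin n) (Fin k) ℝ} (hX : Xᵀ * X = 1)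
    (hZ : ∀ d, Z *ᵥ d = 0 → d = 0) :
    ∃ (O : Matrix (Fin n) (Fin n) ℝ) (R : Matrix (Fin k) (Fin k) ℝ), Oᵀ * O = 1 ∧ O * Z = X * R := by
  have hXinj : ∀ d, X *ᵥ d = 0 → d = 0 := fun d hd => by
    have : Xᵀ *ᵥ (X *ᵥ d) = d := by rw [mulVec_mulVec, hX, one_mulVec]
    rw [← this, hd, mulVec_zero]
  have key : ∀ M : Matrix (Fin n) (Fin k) ℝ, (∀ d, M *ᵥ d = 0 → d = 0) →
      Module.finrank ℝ (LinearMap.range (toEuclideanLin M)) = k := by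
    intro M hM
    rw [LinearMap.finrank_range_of_inj, finrank_euclideanSpace_fin]
    rw [← LinearMap.ker_eq_bot, LinearMap.ker_eq_bot']
    intro m hm
    have := hM m.ofLp (by simpa using congrArg WithLp.ofLp hm)
    exact (WithLp.ofLp_injective 2) (by simpa using this)
  set S₁ := LinearMap.range (toEuclideanLin Z)
  set S₂ := LinearMap.range (toEuclideanLin X)
  let b₁ := (stdOrthonormalBasis ℝ S₁).reindex (finCongr (key Z hZ))
  let b₂ := (stdOrthonormalBasis ℝ S₂).reindex (finCongr (key X hXinj))
  let f := (S₂.subtypeₗᵢ.comp (b₁.equiv b₂ (Equiv.refl _)).toLinearIsometry).extend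
  set O := toEuclideanLin.symm f.toLinearMap with hO
  have hOf : ∀ v : Fin n → ℝ, O *ᵥ v = (f (WithLp.toLp 2 v)).ofLp := fun v => by
    have : toEuclideanLin O = f.toLinearMap := by simp [hO]
    have h2 := congrArg (fun g => (g (WithLp.toLp 2 v)).ofLp) this
    simpa using h2
  have hdot : ∀ u v, (O *ᵥ u) ⬝ᵥ (O *ᵥ v) = u ⬝ᵥ v := fun u v => by
    have h := f.inner_map_map (WithLp.toLp 2 u) (WithLp.toLp 2 v)
    simp only [EuclideanSpace.inner_eq_star_dotProduct, star_trivial, ← hOf] at h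
    rw [dotProduct_comm, h, dotProduct_comm]
  have hmem : ∀ d : Fin k → ℝ, ∃ d', O *ᵥ (Z *ᵥ d) = X *ᵥ d' := fun d => by
    have hs : WithLp.toLp 2 (Z *ᵥ d) ∈ S₁ := ⟨WithLp.toLp 2 d, by simp⟩
    have h1 : f (WithLp.toLp 2 (Z *ᵥ d)) ∈ S₂ := by
      have := LinearIsometry.extend_apply
        (S₂.subtypeₗᵢ.comp (b₁.equiv b₂ (Equiv.refl _)).toLinearIsometry) ⟨_, hs⟩
      change f _ = _ at this
      rw [this]
      exact Subtype.property _
    obtain ⟨d', hd'⟩ := h1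
    exact ⟨d'.ofLp, by rw [hOf, ← hd']; simp⟩
  choose g hg using hmem
  refine ⟨O, Matrix.of fun i j => g (Pi.single j 1) i, ?_, ?_⟩
  · ext i j
    have := hdot (Pi.single i 1) (Pi.single j 1)
    rw [dotProduct_mulVec, vecMul_mulVec] at this
    simpa [Matrix.one_apply, Pi.single_apply, eq_comm] using this
  · ext i j
    have := congrFun (hg (Pi.single j 1)) i
    rw [mulVec_mulVec] at this
    simpa [mulVec, dotProduct, Matrix.mul_apply, Pi.single_apply] using this

theorem borelSpace_matrix (m n : ℕ) : BorelSpace (Matrix (Fin m) (Fin n) ℝ) :=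
  inferInstanceAs (BorelSpace (Fin m → Fin n → ℝ))

/-- Fubini turns the Lebesgue statement into one fixed `Z` that is good for almost every `V`.
Rotating `Z` into the column space of `X` transfers this to `X`, and invariance of `ν` absorbs the
rotation. -/
theorem ae_det_ne_zero_of_isUniformOnStiefel {n k : ℕ} {ν : Measure (Matrix (Fin n) (Fin k) ℝ)}
    (hν : IsUniformOnStiefel ν) {X : Matrix (Fin n) (Fin k) ℝ} (hX : Xᵀ * X = 1) :
    ∀ᵐ V ∂ν, (Xᵀ * V).det ≠ 0 := by
  have := borelSpace_matrix n k
  have := hν.isProbabilityMeasure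
  have hmeas : MeasurableSet {p : (Fin n → Fin k → ℝ) × (Fin n → Fin k → ℝ) |
      ((Matrix.of p.1)ᵀ * Matrix.of p.2).det ≠ 0} := by
    have hc : Continuous fun p : (Fin n → Fin k → ℝ) × (Fin n → Fin k → ℝ) =>
        ((Matrix.of p.1)ᵀ * Matrix.of p.2).det :=
      Continuous.matrix_det (Continuous.matrix_mul (Continuous.matrix_transpose continuous_fst)
        continuous_snd)
    exact hc.measurable (measurableSet_singleton 0).compl
  have hZ : ∀ᵐ Z : Fin n → Fin k → ℝ, ∀ᵐ V ∂ν, ((Matrix.of Z)ᵀ * V).det ≠ 0 := by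
    refine (Measure.ae_ae_comm (μ := (volume : Measure (Fin n → Fin k → ℝ))) (ν := ν)
      (p := fun Z V => ((Matrix.of Z)ᵀ * V).det ≠ 0) hmeas).mpr ?_
    filter_upwards [hν.carried] with V hV using ae_det_transpose_mul_ne_zero hV
  obtain ⟨Z, hZ⟩ := hZ.exists
  obtain ⟨V₀, hV₀⟩ := hZ.exists
  -- A single good `V₀` already forces `Z` to have full column rank.
  obtain ⟨O, R, hO, hOZ⟩ := exists_orthogonal_mul_eq_mul (Z := Matrix.of Z) hX fun d hd => by
    refine by_contra fun hd0 => hV₀ ?_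
    rw [← det_transpose]
    refine exists_mulVec_eq_zero_iff.mp ⟨d, hd0, ?_⟩
    rw [transpose_mul, transpose_transpose, ← mulVec_mulVec, hd, mulVec_zero]
  have hcm : Continuous fun Q : Matrix (Fin n) (Fin k) ℝ => O * Q :=
    continuous_const.matrix_mul continuous_id
  have h : ∀ᵐ V ∂ν, (Xᵀ * (O * V)).det ≠ 0 := by
    filter_upwards [hZ] with V hV h0
    have e : Matrix.of Z = Oᵀ * (X * R) := by rw [← hOZ, ← Matrix.mul_assoc, hO, Matrix.one_mul]
    apply hV
    rw [e, transpose_mul, transpose_mul, transpose_transpose, Matrix.mul_assoc, Matrix.mul_assoc,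
      det_mul, h0, mul_zero]
  rw [← hν.invariant O hO]
  rw [ae_map_iff hcm.measurable.aemeasurable]
  · exact h
  · have hc : Continuous fun V : Matrix (Fin n) (Fin k) ℝ => (Xᵀ * V).det :=
      Continuous.matrix_det (continuous_const.matrix_mul continuous_id)
    exact hc.measurable (measurableSet_singleton 0).compl

/-! ### Lower bound for the probability of a cone -/

theorem measurableSet_inCone {ι α : Type*} [Fintype ι] [TopologicalSpace α] [MeasurableSpace α]
    [OpensMeasurableSpace α] (a : ℝ) {c u : α → ι → ℝ} (hc : Continuous c) (hu : Continuous u) :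
    MeasurableSet {p | InCone a (c p) (u p)} := by
  have hcu := (hc.dotProduct hu).pow 2
  have hq := (hc.dotProduct hc).mul (hu.dotProduct hu)
  exact (measurableSet_le (hq.const_mul _).measurable hcu.measurable).inter
    (measurableSet_lt hcu.measurable (hq.const_mul _).measurable)

theorem continuous_crossVec {k : ℕ} : Continuous (crossVec (k := k)) := by
  have h : Continuous fun G : Matrix (Fin k ⊕ Unit) (Fin k) ℝ =>
      (fromCols G (0 : Matrix (Fin k ⊕ Unit) Unit ℝ)).adjugate := by
    refine Continuous.matrix_adjugate (continuous_matrix fun i j => ?_)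
    rcases j with j | j
    · exact continuous_id.matrix_elem i j
    · exact continuous_const
  exact continuous_pi fun j => h.matrix_elem _ j

/-- The cone contains a box with last side `(a s, 2 a s)` and all others `(1/2, 1)`. There `k/4 ≤ z
⬝ᵥ z ≤ k + 1`, so the squared cosine is at least `a ^ 2` and below `16 a ^ 2 (k + 1) / k ≤ 32 a ^
2`; this is why the factor 8 suffices. -/
theorem le_volume_inCone_single {k : ℕ} (hk : 1 ≤ k) {a : ℝ} (ha : 0 < a)
    (ha1 : 2 * (a * √(k + 1)) ≤ 1) :
    ENNReal.ofReal ((1 / 2) ^ k * (a * √(k + 1))) ≤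
      volume {z : Fin k ⊕ Unit → ℝ | z ⬝ᵥ z ≤ k + 1 ∧ InCone a (Pi.single (Sum.inr ()) 1) z} := by
  set s := √((k : ℝ) + 1) with hs
  have hs0 : 0 < s := Real.sqrt_pos.mpr (by positivity)
  have hss : s ^ 2 = k + 1 := Real.sq_sqrt (by positivity)
  have has : 0 < a * s := by positivity
  let lo : Fin k ⊕ Unit → ℝ := Sum.elim (fun _ => 1 / 2) fun _ => a * s
  let hi : Fin k ⊕ Unit → ℝ := Sum.elim (fun _ => 1) fun _ => 2 * (a * s)
  have hvol : volume (Set.univ.pi fun i => Set.Ioo (lo i) (hi i))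
      = ENNReal.ofReal ((1 / 2) ^ k * (a * s)) := by
    rw [Real.volume_pi_Ioo, Fintype.prod_sum_type, ENNReal.ofReal_mul (by positivity),
      ENNReal.ofReal_pow (by positivity)]
    simp only [lo, hi, Sum.elim_inl, Sum.elim_inr, Finset.prod_const, Finset.card_univ,
      Fintype.card_fin, Fintype.card_unit, pow_one]
    congr 3 <;> ring
  rw [← hvol]
  refine measure_mono fun z hz => ?_
  have hl : ∀ j : Fin k, 1 / 2 < z (Sum.inl j) ∧ z (Sum.inl j) < 1 := fun j => by
    simpa [lo, hi] using hz (Sum.inl j) trivial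
  have hr : a * s < z (Sum.inr ()) ∧ z (Sum.inr ()) < 2 * (a * s) := by
    simpa [lo, hi] using hz (Sum.inr ()) trivial
  set x := z (Sum.inr ()) with hx
  have hzz : z ⬝ᵥ z = (∑ j : Fin k, z (Sum.inl j) ^ 2) + x ^ 2 := by
    simp [dotProduct, sq, hx]
  have h1 : ∑ j : Fin k, z (Sum.inl j) ^ 2 ≤ k := by
    calc _ ≤ ∑ j : Fin k, (1 : ℝ) := Finset.sum_le_sum fun j _ => by nlinarith [hl j]
      _ = k := by simp
  have h2 : (k : ℝ) / 4 ≤ ∑ j : Fin k, z (Sum.inl j) ^ 2 := by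
    calc (k : ℝ) / 4 = ∑ j : Fin k, (1 / 4 : ℝ) := by simp; ring
      _ ≤ _ := Finset.sum_le_sum fun j _ => by nlinarith [hl j]
  have hk' : (1 : ℝ) ≤ k := by exact_mod_cast hk
  have hx1 : x ^ 2 ≤ 1 := by nlinarith
  have hxl : a ^ 2 * (k + 1) ≤ x ^ 2 := by rw [← hss]; nlinarith
  have hxu : x ^ 2 < 4 * (a ^ 2 * (k + 1)) := by rw [← hss]; nlinarith
  have hlt : z ⬝ᵥ z ≤ k + 1 := by rw [hzz]; linarith
  have ha2 : 0 < a ^ 2 := by positivity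
  refine ⟨hlt, ?_, ?_⟩
  · simp only [single_one_dotProduct, Pi.single_eq_same, one_mul]
    exact (mul_le_mul_of_nonneg_left hlt ha2.le).trans hxl
  · simp only [single_one_dotProduct, Pi.single_eq_same, one_mul]
    have : (k : ℝ) / 4 ≤ z ⬝ᵥ z := by rw [hzz]; nlinarith [sq_nonneg x]
    have h3 := mul_le_mul_of_nonneg_left this ha2.le
    have h4 := mul_le_mul_of_nonneg_left hk' ha2.le
    change x ^ 2 < _
    nlinarith

theorem volume_inCone {ι : Type*} [Fintype ι] [DecidableEq ι] {e c : ι → ℝ} (he : e ⬝ᵥ e = 1)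
    (hc : c ≠ 0) (a r : ℝ) :
    volume {z : ι → ℝ | z ⬝ᵥ z ≤ r ∧ InCone a c z} =
      volume {z : ι → ℝ | z ⬝ᵥ z ≤ r ∧ InCone a e z} := by
  obtain ⟨W, s, hW, hs, rfl⟩ := exists_orthogonal_mulVec_eq_smul he hc
  have hdet : W.det * W.det = 1 := by
    have := congrArg Matrix.det hW
    rwa [det_mul, det_transpose, det_one] at this
  have hdet0 : W.det ≠ 0 := fun h => by simp [h] at hdet
  have habs : |W.det⁻¹| = 1 := by
    rw [abs_inv, inv_eq_one]
    have : |W.det| * |W.det| = 1 := by rw [← abs_mul, hdet, abs_one]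
    nlinarith [abs_nonneg W.det]
  have hmap := Real.map_matrix_volume_pi_eq_smul_volume_pi hdet0
  rw [habs, ENNReal.ofReal_one, one_smul] at hmap
  have hm : Continuous (Matrix.toLin' W) := (Matrix.toLin' W).continuous_of_finiteDimensional
  have hmeas : MeasurableSet {z : ι → ℝ | z ⬝ᵥ z ≤ r ∧ InCone a (s • W *ᵥ e) z} :=
    (measurableSet_le (continuous_id.dotProduct continuous_id).measurable measurable_const).inter
      (measurableSet_inCone a continuous_const continuous_id)
  conv_lhs => rw [← hmap]
  rw [Measure.map_apply hm.measurable hmeas]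
  congr 1
  ext z
  simp only [Set.mem_preimage, Set.mem_ofPred_eq, toLin'_apply, dotProduct_orthogonal hW,
    inCone_smul_left hs, inCone_orthogonal hW]

theorem ae_crossVec_ne_zero {n k : ℕ} {ν : Measure (Matrix (Fin n) (Fin k) ℝ)}
    (hν : IsUniformOnStiefel ν) {X : Matrix (Fin n) (Fin k ⊕ Unit) ℝ} (hX : Xᵀ * X = 1) :
    ∀ᵐ V ∂ν, (X.toCols₁ᵀ * V).det ≠ 0 ∧ crossVec (Xᵀ * V) ≠ 0 := by
  have h1 : X.toCols₁ᵀ * X.toCols₁ = 1 := by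
    ext i j
    have := congrFun (congrFun hX (Sum.inl i)) (Sum.inl j)
    simpa [Matrix.mul_apply, Matrix.one_apply] using this
  filter_upwards [ae_det_ne_zero_of_isUniformOnStiefel hν h1] with V hV
  refine ⟨hV, fun h => hV ?_⟩
  have := crossVec_inr (Xᵀ * V)
  rw [h, Pi.zero_apply] at this
  rw [this]
  rfl

/-- The direction of the cross product has a rotation invariant law, so the axis does not matter; `z
= 0` gives the empty cone, whence only an inequality. -/
theorem measure_inCone_le {n k : ℕ} {ν : Measure (Matrix (Fin n) (Fin k) ℝ)}
    (hν : IsUniformOnStiefel ν) {X : Matrix (Fin n) (Fin k ⊕ Unit) ℝ} (hX : Xᵀ * X = 1)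
    {e : Fin k ⊕ Unit → ℝ} (he : e ⬝ᵥ e = 1) (a : ℝ) (z : Fin k ⊕ Unit → ℝ) :
    ν {V | InCone a (crossVec (Xᵀ * V)) z} ≤ ν {V | InCone a (crossVec (Xᵀ * V)) e} := by
  have := borelSpace_matrix n k
  rcases eq_or_ne z 0 with rfl | hz
  · simp [InCone]
  obtain ⟨W, s, hW, hs, rfl⟩ := exists_orthogonal_mulVec_eq_smul he hz
  have hW' : Wᵀᵀ * Wᵀ = 1 := by rw [transpose_transpose]; exact mul_eq_one_comm.mp hW
  have hdet : Wᵀ.det ≠ 0 := fun h => by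
    have := congrArg Matrix.det hW
    rw [det_mul, h, zero_mul, det_one] at this
    exact zero_ne_one this
  -- Acts as `Wᵀ` on the column space of `X` and as the identity on its orthogonal complement.
  set O := X * Wᵀ * Xᵀ + (1 - X * Xᵀ) with hO
  have hXO : Xᵀ * O = Wᵀ * Xᵀ := by
    rw [hO, Matrix.mul_add, Matrix.mul_sub, ← Matrix.mul_assoc, ← Matrix.mul_assoc,
      ← Matrix.mul_assoc, hX, Matrix.one_mul, Matrix.mul_one, Matrix.one_mul, sub_self, add_zero]
  have hOO : Oᵀ * O = 1 := by
    have hOT : Oᵀ = X * W * Xᵀ + (1 - X * Xᵀ) := by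
      rw [hO]; simp [Matrix.mul_assoc]
    have h1 : (1 - X * Xᵀ) * O = 1 - X * Xᵀ := by
      rw [Matrix.sub_mul, Matrix.one_mul, Matrix.mul_assoc, hXO, hO, Matrix.mul_assoc]; abel
    rw [hOT, Matrix.add_mul, h1, Matrix.mul_assoc, hXO, Matrix.mul_assoc, ← Matrix.mul_assoc W,
      mul_eq_one_comm.mp hW, Matrix.one_mul]
    abel
  have hcm : Continuous fun Q : Matrix (Fin n) (Fin k) ℝ => O * Q :=
    continuous_const.matrix_mul continuous_id
  have hcc : Continuous fun V : Matrix (Fin n) (Fin k) ℝ => crossVec (Xᵀ * V) :=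
    continuous_crossVec.comp (continuous_const.matrix_mul continuous_id)
  conv_rhs => rw [← hν.invariant O hOO]
  rw [Measure.map_apply hcm.measurable (measurableSet_inCone a hcc continuous_const)]
  refine measure_mono fun V hV => ?_
  change InCone a (crossVec (Xᵀ * (O * V))) e
  change InCone a (crossVec (Xᵀ * V)) (s • W *ᵥ e) at hV
  rw [← Matrix.mul_assoc, hXO, Matrix.mul_assoc, crossVec_mul hW', inCone_smul_left hdet]
  rw [inCone_comm, inCone_smul_left hs, inCone_comm, ← inCone_orthogonal hW', mulVec_mulVec, hW,
    one_mulVec] at hV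
  exact hV

/-- Anti-concentration from below: the last coordinate of the normalized cross product of `Xᵀ V`
has a density bounded below near `0`, uniformly in the ambient dimension. -/
theorem exists_le_measureReal_inCone {k : ℕ} (hk : 1 ≤ k) :
    ∃ κ a₀ : ℝ, 0 < κ ∧ 0 < a₀ ∧ ∀ (n : ℕ) (ν : Measure (Matrix (Fin n) (Fin k) ℝ)),
      IsUniformOnStiefel ν → ∀ X : Matrix (Fin n) (Fin k ⊕ Unit) ℝ, Xᵀ * X = 1 →
      ∀ a, 0 < a → a ≤ a₀ →
        κ * a ≤ ν.real {V | InCone a (crossVec (Xᵀ * V)) (Pi.single (Sum.inr ()) 1)} := by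
  set e : Fin k ⊕ Unit → ℝ := Pi.single (Sum.inr ()) 1 with he
  have hee : e ⬝ᵥ e = 1 := by simp [he]
  set s := √((k : ℝ) + 1) with hs
  have hs0 : 0 < s := Real.sqrt_pos.mpr (by positivity)
  set B : Set (Fin k ⊕ Unit → ℝ) := {z | z ⬝ᵥ z ≤ k + 1} with hB
  have hBtop : volume B ≠ ⊤ := by
    refine ((Metric.isBounded_closedBall (x := (0 : Fin k ⊕ Unit → ℝ))
      (r := (k : ℝ) + 1)).subset ?_).measure_lt_top.ne
    intro z hz
    rw [mem_closedBall_zero_iff, pi_norm_le_iff_of_nonneg (by positivity)]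
    intro i
    have h1 : z i * z i ≤ z ⬝ᵥ z :=
      Finset.single_le_sum (f := fun i => z i * z i) (fun i _ => mul_self_nonneg _)
        (Finset.mem_univ i)
    have h2 : z ⬝ᵥ z ≤ k + 1 := hz
    have hk0 : (0 : ℝ) ≤ k := Nat.cast_nonneg k
    rw [Real.norm_eq_abs]
    nlinarith [abs_mul_abs_self (z i), abs_nonneg (z i)]
  have hBm : MeasurableSet B :=
    measurableSet_le (continuous_id.dotProduct continuous_id).measurable measurable_const
  set b := volume.real B with hb
  -- Double counting over pairs `(z, V)` with `z` in the ball `B`: `h3` bounds the slices at fixed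
  -- `z` from above, `h4` those at fixed `V` from below. No explicit density is needed.
  have key : ∀ (n : ℕ) (ν : Measure (Matrix (Fin n) (Fin k) ℝ)),
      IsUniformOnStiefel ν → ∀ X : Matrix (Fin n) (Fin k ⊕ Unit) ℝ, Xᵀ * X = 1 →
      ∀ a, 0 < a → 2 * (a * s) ≤ 1 →
        (1 / 2) ^ k * (a * s) ≤ ν.real {V | InCone a (crossVec (Xᵀ * V)) e} * b := by
    intro n ν hν X hX a ha ha1
    have := borelSpace_matrix n k
    have := hν.isProbabilityMeasure
    have : SecondCountableTopology (Matrix (Fin n) (Fin k) ℝ) :=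
      inferInstanceAs (SecondCountableTopology (Fin n → Fin k → ℝ))
    let T : Set ((Fin k ⊕ Unit → ℝ) × Matrix (Fin n) (Fin k) ℝ) :=
      {p | InCone a (crossVec (Xᵀ * p.2)) p.1}
    have hT : MeasurableSet T := measurableSet_inCone a
      (continuous_crossVec.comp (continuous_const.matrix_mul continuous_snd)) continuous_fst
    have h3 : ((volume.restrict B).prod ν) T
        ≤ ν {V | InCone a (crossVec (Xᵀ * V)) e} * volume B := by
      rw [Measure.prod_apply hT, ← setLIntegral_const]
      exact lintegral_mono fun z => measure_inCone_le hν hX hee a z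
    have h4 : ENNReal.ofReal ((1 / 2) ^ k * (a * s)) ≤ ((volume.restrict B).prod ν) T := by
      rw [Measure.prod_apply_symm hT]
      calc ENNReal.ofReal ((1 / 2) ^ k * (a * s))
          = ∫⁻ _, ENNReal.ofReal ((1 / 2) ^ k * (a * s)) ∂ν := by simp
        _ ≤ _ := by
          refine lintegral_mono_ae ?_
          filter_upwards [ae_crossVec_ne_zero hν hX] with V hV
          rw [Measure.restrict_apply' hBm, Set.inter_comm]
          exact (le_volume_inCone_single hk ha ha1).trans_eq
            (volume_inCone (by simp) hV.2 a _).symm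
    have h5 := h4.trans h3
    rw [← ENNReal.ofReal_toReal (measure_ne_top ν _), ← ENNReal.ofReal_toReal hBtop,
      ← ENNReal.ofReal_mul ENNReal.toReal_nonneg] at h5
    exact (ENNReal.ofReal_le_ofReal_iff (by positivity)).mp h5
  have hb0 : 0 < b := by
    have h1 := le_volume_inCone_single hk (a := 1 / (2 * s)) (by positivity)
      (le_of_eq (by rw [← hs]; field_simp))
    have h2 : 0 < volume B := lt_of_lt_of_le
      (ENNReal.ofReal_pos.mpr (by rw [← hs]; positivity))
      (h1.trans (measure_mono fun z hz => hz.1))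
    exact ENNReal.toReal_pos h2.ne' hBtop
  refine ⟨(1 / 2) ^ k * s / b, 1 / (2 * s), by positivity, by positivity, ?_⟩
  intro n ν hν X hX a ha ha1
  have := key n ν hν X hX a ha (by rw [le_div_iff₀ (by positivity)] at ha1; linarith)
  rw [div_mul_eq_mul_div, div_le_iff₀ hb0]
  linarith

theorem not_inCone_of_inCone {ι : Type*} [Fintype ι] {a b : ℝ} (hb : 0 < b) (hab : 8 * b ≤ a)
    {c u : ι → ℝ} (h : InCone a c u) : ¬ InCone b c u := fun h' => by
  have hq : 0 ≤ (c ⬝ᵥ c) * (u ⬝ᵥ u) := by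
    have h1 : 0 ≤ c ⬝ᵥ c := Finset.sum_nonneg fun i _ => mul_self_nonneg _
    have h2 : 0 ≤ u ⬝ᵥ u := Finset.sum_nonneg fun i _ => mul_self_nonneg _
    positivity
  have h1 : (8 * b) ^ 2 ≤ a ^ 2 := by gcongr
  have h2 := mul_le_mul_of_nonneg_right h1 hq
  linarith [h.1, h'.2]

/-! ### Products of independent coordinates -/

/-- The product of two independent such coordinates has a density unbounded near `0`. -/
theorem exists_mul_le_measureReal_mul_lt {k : ℕ} (hk : 1 ≤ k) (C : ℝ) :
    ∃ t₀ : ℝ, 0 < t₀ ∧ ∀ (n : ℕ) (X Y : Matrix (Fin n) (Fin k ⊕ Unit) ℝ),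
      Xᵀ * X = 1 → Yᵀ * Y = 1 →
      ∀ (Ω : Type*) [MeasurableSpace Ω] (P : Measure Ω) [IsProbabilityMeasure P]
        (U V : Ω → Matrix (Fin n) (Fin k) ℝ), Measurable U → Measurable V → IndepFun U V P →
        IsUniformOnStiefel (P.map U) → IsUniformOnStiefel (P.map V) →
      ∀ (f g : Ω → ℝ),
        (∀ᵐ ω ∂P, ∀ r, 0 < r →
          InCone r (crossVec (Xᵀ * V ω)) (Pi.single (Sum.inr ()) 1) → |f ω| < 8 * r) →
        (∀ᵐ ω ∂P, ∀ r, 0 < r →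
          InCone r (crossVec (Yᵀ * U ω)) (Pi.single (Sum.inr ()) 1) → |g ω| < 8 * r) →
      ∀ t, 0 < t → t < t₀ → C * t ≤ P.real {ω | |f ω| * |g ω| < t} := by
  obtain ⟨κ, a₀, hκ, ha₀, H⟩ := exists_le_measureReal_inCone hk
  -- Each of the `J` disjoint events below has probability at least `κ ^ 2 t / 64`. The threshold on
  -- `t` keeps every `β j` with `j < J` below `a₀`.
  obtain ⟨J, hJ⟩ := exists_nat_ge (C * 64 / κ ^ 2)
  refine ⟨64 * a₀ * (a₀ * (1 / 8) ^ J), by positivity, ?_⟩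
  intro n X Y hX hY Ω _ P _ U V hU hV hUV hνU hνV f g hf hg t ht htt
  have := borelSpace_matrix n k
  let S (Q : Matrix (Fin n) (Fin k ⊕ Unit) ℝ) (a : ℝ) : Set (Matrix (Fin n) (Fin k) ℝ) :=
    {M | InCone a (crossVec (Qᵀ * M)) (Pi.single (Sum.inr ()) 1)}
  have hS : ∀ Q a, MeasurableSet (S Q a) := fun Q a => measurableSet_inCone a
    (continuous_crossVec.comp (continuous_const.matrix_mul continuous_id)) continuous_const
  let α (j : ℕ) : ℝ := a₀ * (1 / 8) ^ j
  -- Chosen so that `(8 * α j) * (8 * β j) = t`.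
  let β (j : ℕ) : ℝ := t / (64 * α j)
  have hα : ∀ j, 0 < α j := fun j => by positivity
  have hβ : ∀ j, 0 < β j := fun j => div_pos ht (mul_pos (by norm_num) (hα j))
  have hα₀ : ∀ j, α j ≤ a₀ := fun j =>
    mul_le_of_le_one_right ha₀.le (pow_le_one₀ (by norm_num) (by norm_num))
  have hβ₀ : ∀ j ∈ Finset.range J, β j ≤ a₀ := fun j hj => by
    rw [div_le_iff₀ (mul_pos (by norm_num) (hα j))]
    have : α J ≤ α j := mul_le_mul_of_nonneg_left
      (pow_le_pow_of_le_one (by norm_num) (by norm_num) (Finset.mem_range.mp hj).le) ha₀.le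
    calc t ≤ 64 * a₀ * α J := htt.le
      _ ≤ 64 * a₀ * α j := by gcongr
      _ = _ := by ring
  let E (j : ℕ) : Set Ω := U ⁻¹' S Y (α j) ∩ V ⁻¹' S X (β j)
  have hE : ∀ j, MeasurableSet (E j) := fun j => (hU (hS _ _)).inter (hV (hS _ _))
  have hmem : ∀ j ∈ Finset.range J, κ ^ 2 / 64 * t ≤ P.real (E j) := fun j hj => by
    have e : P.real (E j) = P.real (U ⁻¹' S Y (α j)) * P.real (V ⁻¹' S X (β j)) := by
      simp only [measureReal_def, E]
      rw [indepFun_iff_measure_inter_preimage_eq_mul.mp hUV _ _ (hS _ _) (hS _ _),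
        ENNReal.toReal_mul]
    have h1 := H n _ hνU Y hY (α j) (hα j) (hα₀ j)
    have h2 := H n _ hνV X hX (β j) (hβ j) (hβ₀ j hj)
    rw [map_measureReal_apply hU (hS _ _)] at h1
    rw [map_measureReal_apply hV (hS _ _)] at h2
    rw [e]
    calc κ ^ 2 / 64 * t = (κ * α j) * (κ * β j) := by
          have := (hα j).ne'
          simp only [β]; field_simp
      _ ≤ _ := mul_le_mul h1 h2 (mul_pos hκ (hβ j)).le measureReal_nonneg
  have hlt : ∀ i j, i < j → Disjoint (E i) (E j) := fun i j hij => by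
    rw [Set.disjoint_left]
    intro ω hi hj
    refine not_inCone_of_inCone (hα j) ?_ hi.1 hj.1
    have : ((1 : ℝ) / 8) ^ j ≤ (1 / 8) ^ (i + 1) :=
      pow_le_pow_of_le_one (by norm_num) (by norm_num) hij
    rw [pow_succ] at this
    simp only [α]
    nlinarith
  have hdisj : (↑(Finset.range J) : Set ℕ).PairwiseDisjoint E := fun i _ j _ hij => by
    rcases lt_or_gt_of_ne hij with h | h
    · exact hlt i j h
    · exact (hlt j i h).symm
  -- An almost everywhere inclusion suffices, so `f` and `g` need not be measurable.
  have hsub : (⋃ j ∈ Finset.range J, E j) ≤ᵐ[P] {ω | |f ω| * |g ω| < t} := by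
    filter_upwards [hf, hg] with ω h1 h2 h3
    obtain ⟨j, -, hj⟩ := Set.mem_iUnion₂.mp h3
    have h4 := h1 (β j) (hβ j) hj.2
    have h5 := h2 (α j) (hα j) hj.1
    change |f ω| * |g ω| < t
    calc |f ω| * |g ω| < (8 * β j) * (8 * α j) :=
          mul_lt_mul'' h4 h5 (abs_nonneg _) (abs_nonneg _)
      _ = t := by
          have := (hα j).ne'
          simp only [β]; field_simp; norm_num
  calc C * t ≤ J * (κ ^ 2 / 64 * t) := by
        rw [div_le_iff₀ (by positivity)] at hJ
        nlinarith
    _ = ∑ j ∈ Finset.range J, κ ^ 2 / 64 * t := by simp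
    _ ≤ ∑ j ∈ Finset.range J, P.real (E j) := Finset.sum_le_sum hmem
    _ = P.real (⋃ j ∈ Finset.range J, E j) :=
        (measureReal_biUnion_finset hdisj fun j _ => hE j).symm
    _ ≤ _ := ENNReal.toReal_mono (measure_ne_top _ _) (measure_mono_ae hsub)

/-! ### Eigenvectors of the perturbed pencil -/

theorem mem_colSpan_iff {n : ℕ} {ι : Type*} [Fintype ι] {X : Matrix (Fin n) ι ℝ} {v : Fin n → ℝ} :
    v ∈ colSpan X ↔ ∃ c, X *ᵥ c = v := by
  have : colSpan X = LinearMap.range X.mulVecLin := by rw [range_mulVecLin]; rfl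
  rw [this]; rfl

theorem mul_eq_zero_of_colSpan_le_ker {n : ℕ} {ι : Type*} [Fintype ι] [DecidableEq ι]
    {X : Matrix (Fin n) ι ℝ} {M : Matrix (Fin n) (Fin n) ℝ}
    (h : colSpan X ≤ LinearMap.ker M.mulVecLin) : M * X = 0 := by
  ext i j
  have h1 : M *ᵥ (X *ᵥ Pi.single j 1) = 0 := h (mem_colSpan_iff.mpr ⟨Pi.single j 1, rfl⟩)
  have := congrFun h1 i
  rw [mulVec_mulVec] at this
  simpa using this

/-- An eigenvector of a rank completing perturbation is an unperturbed one. -/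
theorem transpose_mulVec_eq_zero_of_add_mulVec_eq_zero {n k : ℕ} {M : Matrix (Fin n) (Fin n) ℝ}
    {U V Y : Matrix (Fin n) (Fin k) ℝ} {D : Matrix (Fin k) (Fin k) ℝ} {τ : ℝ} {v : Fin n → ℝ}
    (hY : Mᵀ * Y = 0) (hYU : (Yᵀ * U).det ≠ 0) (hD : D.det ≠ 0) (hτ : τ ≠ 0)
    (hv : (M + τ • (U * D * Vᵀ)) *ᵥ v = 0) : Vᵀ *ᵥ v = 0 ∧ M *ᵥ v = 0 := by
  have hYM : Yᵀ * M = 0 := by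
    rw [← transpose_transpose M, ← transpose_mul, hY, transpose_zero]
  -- Multiplication by `Yᵀ` kills `M` and leaves only the perturbation.
  have h1 : (τ • (Yᵀ * U * D)) *ᵥ (Vᵀ *ᵥ v) = 0 := by
    have := congrArg (Yᵀ *ᵥ ·) hv
    simp only [mulVec_mulVec, mulVec_zero, Matrix.mul_add, hYM, zero_add, Matrix.mul_smul] at this
    rw [mulVec_mulVec, Matrix.smul_mul]
    simpa only [Matrix.mul_assoc] using this
  have h2 : Vᵀ *ᵥ v = 0 := by
    rw [smul_mulVec] at h1
    refine eq_zero_of_mulVec_eq_zero ?_ ((smul_eq_zero.mp h1).resolve_left hτ)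
    rw [det_mul]
    exact mul_ne_zero hYU hD
  refine ⟨h2, ?_⟩
  rwa [add_mulVec, smul_mulVec, ← mulVec_mulVec, h2, mulVec_zero, smul_zero, add_zero] at hv

/-- The coordinate vector of `v` is a unit vector orthogonal to the columns of `XᵀV`, so its last
entry is, up to sign, the cosine measured by `InCone`. -/
theorem appendCol_coordinates {n k : ℕ} {X₁ : Matrix (Fin n) (Fin k) ℝ} {x v : Fin n → ℝ}
    {V : Matrix (Fin n) (Fin k) ℝ} (hX : (appendCol X₁ x)ᵀ * appendCol X₁ x = 1)
    (hv : v ∈ colSpan (appendCol X₁ x)) (hv1 : v ⬝ᵥ v = 1) (hV : Vᵀ *ᵥ v = 0)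
    (hc : crossVec ((appendCol X₁ x)ᵀ * V) ≠ 0) :
    (∃ a, v = X₁ *ᵥ a + (x ⬝ᵥ v) • x) ∧ ∀ r, 0 < r →
      InCone r (crossVec ((appendCol X₁ x)ᵀ * V)) (Pi.single (Sum.inr ()) 1) →
        |x ⬝ᵥ v| < 8 * r := by
  obtain ⟨c, rfl⟩ := mem_colSpan_iff.mp hv
  set X := appendCol X₁ x with hXdef
  have hdot : ∀ u w, (X *ᵥ u) ⬝ᵥ (X *ᵥ w) = u ⬝ᵥ w := fun u w => by
    rw [dotProduct_mulVec, vecMul_mulVec, hX, vecMul_one]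
  have hx : x = X *ᵥ Pi.single (Sum.inr ()) 1 := by
    ext i; simp [hXdef, appendCol]
  have hxv : x ⬝ᵥ (X *ᵥ c) = c (Sum.inr ()) := by
    conv_lhs => rw [hx]
    rw [hdot, single_one_dotProduct]
  rw [hdot] at hv1
  refine ⟨⟨fun j => c (Sum.inl j), ?_⟩, fun r hr h => ?_⟩
  · rw [hxv]
    ext i
    simp [hXdef, appendCol, mulVec, dotProduct, mul_comm]
  · have hG : (Xᵀ * V)ᵀ *ᵥ c = 0 := by
      rw [transpose_mul, transpose_transpose, ← mulVec_mulVec, hV]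
    have h1 := sq_crossVec_dotProduct hc hG hv1 (Pi.single (Sum.inr ()) 1)
    have hpos : 0 < crossVec (Xᵀ * V) ⬝ᵥ crossVec (Xᵀ * V) := by
      simpa using dotProduct_star_self_pos_iff.mpr hc
    have h2 := h.2
    rw [h1, dotProduct_single_one, dotProduct_single_one, Pi.single_eq_same, mul_one, mul_comm,
      mul_lt_mul_iff_left₀ hpos] at h2
    rw [hxv]
    exact abs_lt_of_sq_lt_sq h2 (by positivity)

theorem rankCompleting_sub_smul {n k : ℕ} (A B : Matrix (Fin n) (Fin n) ℝ) (τ μ : ℝ)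
    (U V : Matrix (Fin n) (Fin k) ℝ) (a b : Fin k → ℝ) :
    rankCompleting A τ U V a - μ • rankCompleting B τ U V b
      = (A - μ • B) + τ • (U * (diagonal a - μ • diagonal b) * Vᵀ) := by
  simp only [rankCompleting, Matrix.mul_sub, Matrix.sub_mul, smul_add, smul_sub, Matrix.mul_smul,
    Matrix.smul_mul, smul_comm μ τ]
  abel

/-! ### The probability bound -/

theorem lemma4p9 (k : ℕ) (hk : 1 ≤ k) :
    ∃ r : ℝ → ℝ, r =O[𝓝 0] (fun t : ℝ => t ^ 2) ∧
      ∀ (n : ℕ) (A B : Matrix (Fin n) (Fin n) ℝ) (μ : ℝ),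
        nrank A B + k = n →
        IsSimpleEigenvalue (A.map Complex.ofReal) (B.map Complex.ofReal) (μ : ℂ) →
      ∀ (X₁ : Matrix (Fin n) (Fin k) ℝ) (x : Fin n → ℝ)
        (Y₁ : Matrix (Fin n) (Fin k) ℝ) (y : Fin n → ℝ),
        IsRightAdapted A B μ X₁ x →
        IsLeftAdapted A B μ Y₁ y →
      ∀ (Ω : Type*) [MeasurableSpace Ω] (P : Measure Ω) [IsProbabilityMeasure P]
        (U V : Ω → Matrix (Fin n) (Fin k) ℝ),
        Measurable U → Measurable V → IndepFun U V P →
        IsUniformOnStiefel (P.map U) → IsUniformOnStiefel (P.map V) →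
      ∀ (τ : ℝ) (dA dB : Ω → Fin k → ℝ),
        τ ≠ 0 →
        (∀ᵐ ω ∂P, (Matrix.diagonal (dA ω) - μ • Matrix.diagonal (dB ω)).det ≠ 0) →
      ∀ (xi yi : Ω → Fin n → ℝ),
        (∀ᵐ ω ∂P, IsUnitRightEigenvector (rankCompleting A τ (U ω) (V ω) (dA ω))
          (rankCompleting B τ (U ω) (V ω) (dB ω)) μ (xi ω)) →
        (∀ᵐ ω ∂P, IsUnitLeftEigenvector (rankCompleting A τ (U ω) (V ω) (dA ω))
          (rankCompleting B τ (U ω) (V ω) (dB ω)) μ (yi ω)) →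
      -- the numbers `x ⬝ᵥ xi`, `y ⬝ᵥ yi` are the last coordinates `α`, `β` of the eigenvectors
      -- with respect to the columns of `[X₁ x]` and `[Y₁ y]`
      (∀ᵐ ω ∂P,
        (∃ a : Fin k → ℝ, xi ω = X₁ *ᵥ a + (x ⬝ᵥ xi ω) • x) ∧
        (∃ b : Fin k → ℝ, yi ω = Y₁ *ᵥ b + (y ⬝ᵥ yi ω) • y) ∧
        (V ω)ᵀ *ᵥ xi ω = 0 ∧ (U ω)ᵀ *ᵥ yi ω = 0) ∧
      ∀ t : ℝ, √(8 * ((k : ℝ) - 1) / Real.pi) * t + r t ≤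
        P.real {ω | |x ⬝ᵥ xi ω| * |y ⬝ᵥ yi ω| < t} := by
  obtain ⟨t₀, ht₀, H⟩ := exists_mul_le_measureReal_mul_lt hk (√(8 * ((k : ℝ) - 1) / Real.pi))
  set C := √(8 * ((k : ℝ) - 1) / Real.pi) with hC
  have hC0 : 0 ≤ C := Real.sqrt_nonneg _
  -- Zero near `0`; for `t ≥ t₀` it cancels the linear term, leaving only nonnegativity of the
  -- probability.
  refine ⟨fun t => if t < t₀ then 0 else -(C * t), ?_, ?_⟩
  · refine IsBigO.congr' (f₁ := fun _ => (0 : ℝ)) (isBigO_zero _ _) ?_ EventuallyEq.rfl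
    filter_upwards [gt_mem_nhds ht₀] with t ht
    simp [ht]
  intro n A B μ _ _ X₁ x Y₁ y hX hY Ω _ P _ U V hU hV hUV hνU hνV τ dA dB hτ hD xi yi hxi hyi
  have hMY : (A - μ • B)ᵀ * Y₁ = 0 :=
    mul_eq_zero_of_colSpan_le_ker (hY.span_fst.le.trans inf_le_left)
  have hMX : (A - μ • B)ᵀᵀ * X₁ = 0 := by
    rw [transpose_transpose]
    exact mul_eq_zero_of_colSpan_le_ker (hX.span_fst.le.trans inf_le_left)
  have hcY := ae_of_ae_map hU.aemeasurable (ae_crossVec_ne_zero hνU hY.orthonormal)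
  have hcX := ae_of_ae_map hV.aemeasurable (ae_crossVec_ne_zero hνV hX.orthonormal)
  have hmain : ∀ᵐ ω ∂P, ((V ω)ᵀ *ᵥ xi ω = 0 ∧ (U ω)ᵀ *ᵥ yi ω = 0) ∧
      ((∃ a : Fin k → ℝ, xi ω = X₁ *ᵥ a + (x ⬝ᵥ xi ω) • x) ∧ ∀ r, 0 < r →
        InCone r (crossVec ((appendCol X₁ x)ᵀ * V ω)) (Pi.single (Sum.inr ()) 1) →
          |x ⬝ᵥ xi ω| < 8 * r) ∧
      ((∃ b : Fin k → ℝ, yi ω = Y₁ *ᵥ b + (y ⬝ᵥ yi ω) • y) ∧ ∀ r, 0 < r →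
        InCone r (crossVec ((appendCol Y₁ y)ᵀ * U ω)) (Pi.single (Sum.inr ()) 1) →
          |y ⬝ᵥ yi ω| < 8 * r) := by
    filter_upwards [hcX, hcY, hD, hxi, hyi] with ω hx hy hd ⟨h1, h1'⟩ ⟨h2, h2'⟩
    rw [rankCompleting_sub_smul] at h1 h2
    have hr := transpose_mulVec_eq_zero_of_add_mulVec_eq_zero hMY hy.1 hd hτ h1
    -- The left eigenvector is a right one of the transposed pencil, with `U` and `V` exchanged.
    have hl := transpose_mulVec_eq_zero_of_add_mulVec_eq_zero (U := V ω) (V := U ω) hMX hx.1 hd hτ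
      (v := yi ω) (by
        rw [← mulVec_transpose] at h2
        simpa [Matrix.mul_assoc] using h2)
    exact ⟨⟨hr.1, hl.1⟩,
      appendCol_coordinates hX.orthonormal (hX.span_all.ge hr.2) h1' hr.1 hx.2,
      appendCol_coordinates hY.orthonormal (hY.span_all.ge hl.2) h2' hl.1 hy.2⟩
  refine ⟨hmain.mono fun ω h => ⟨h.2.1.1, h.2.2.1, h.1.1, h.1.2⟩, fun t => ?_⟩
  beta_reduce
  split_ifs with ht
  · rw [add_zero]
    rcases le_or_gt t 0 with h | h
    · exact (mul_nonpos_of_nonneg_of_nonpos hC0 h).trans measureReal_nonneg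
    · exact H n _ _ hX.orthonormal hY.orthonormal Ω P U V hU hV hUV hνU hνV _ _
        (hmain.mono fun ω h => h.2.1.2) (hmain.mono fun ω h => h.2.2.2) t h ht
  · rw [add_neg_cancel]
    exact measureReal_nonneg
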